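/- **Setting.** Let $\Gamma$ be a metric graph, i.e. a finite graph (loops and multiple edges allowed) in which every edge is identified with a real interval of positive finite length. For a point $v\in\Gamma$ let $T_v(\Gamma)$ be the finite set of outgoing tangent vectors at $v$; the valence of $v$ is $|T_v(\Gamma)|$. For a continuous piecewise linear function $f:\Gamma\to\mathbb R$ with integer slopes let $\mathrm{sl}_\eta(f)\in\mathbb Z$ be its outgoing slope along $\eta$, and put $\mathrm{ord}_v(f)=-\sum_{\eta\in T_v(\Gamma)}\mathrm{sl}_\eta(f)$ and $\mathrm{div}(f)=\sum_v \mathrm{ord}_v(f)\cdot v$. For a divisor $D$ on $\Gamma$ let $R(D)$ be the set of such $f$ with $D+\mathrm{div}(f)\ge 0$. A tropical submodule is a set of functions closed under tropical linear combinations $\min\{f_1+a_1,\dots,f_n+a_n\}$ ($n\ge 1$, $a_i\in\mathbb R$); it is finitely generated if it consists of all tropical linear combinations of finitely many functions. A finite set of functions is tropically dependent if real constants can be added to its members so that at every point of $\Gamma$ the minimum is attained by at least two of them. A *tropical linear series of rank $r\ge 0$* is a pair $(D,\Sigma)$, with $D$ a divisor and $\Sigma\subseteq R(D)$ a finitely generated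 tropical submodule, such that 1. for every effective divisor $E$ of degree $r$ there is $f\in\Sigma$ with $\mathrm{div}(f)+D\ge E$; and 2. every set of $r+2$ functions in $\Sigma$ is tropically dependent. It is *strongly recursive* if moreover (recursively in $r$; a subseries of $(D,\Sigma)$ is a pair $(D,\Sigma')$ with $\Sigma'\subseteq\Sigma$) 3. if $r\ge 1$, every set of $r$ functions in $\Sigma$ is contained in a strongly recursive tropical linear subseries of rank $r-1$; and 4. if $S_1,S_2\subseteq\Sigma$ have sizes $s_1,s_2\le r$ with $s_1+s_2\ge r+2$, then there are strongly recursive tropical linear subseries $\Sigma_1\supseteq S_1$ and $\Sigma_2\supseteq S_2$ of ranks $s_1-1$ and $s_2-1$ such that $\Sigma_1\cap\Sigma_2$ contains a strongly recursive tropical linear series (with the same $D$) of rank $s_1+s_2-r-2$. Let $[r]=\{0,1,\dots,r\}$, and order $[r]^d$ componentwise, so that the meet is the coordinatewise minimum. For $P\subseteq[r]^d$ (a dot array), the rank of $P$ along the $i$-axis is the number of distinct $i$-th coordinates of elements of $P$, minus one; $P$ has rank $s$ if its rank along every axis is $s$, and is rankable if it has some rank. $P$ is totally rankable if $\{\mathbf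 y\in P:\mathbf y\succeq\mathbf x\}$ is rankable for every $\mathbf x\in[r]^d$. A position $\mathbf x\in[r]^d$ is redundant for $P$ if it is the meet of a set of at least two elements of $P$, each of which has at least one coordinate in common with $\mathbf x$; $R(P)$ is the set of redundant positions. A *permutation array of rank $r$ and dimension $d$* is a totally rankable $P\subseteq[r]^d$ of rank $r$ with $P\cap R(P)=\emptyset$, and its *redundant closure* is $\overline P=P\cup R(P)$. **Theorem.** Let $(D,\Sigma)$ be a strongly recursive tropical linear series of rank $r$ on $\Gamma$, let $v\in\Gamma$ be a point of valence $d$, and let $\eta_1,\dots,\eta_d$ be the tangent vectors at $v$, in any order. Then for each $i$ the set of slopes $\{\mathrm{sl}_{\eta_i}(f):f\in\Sigma\}$ has exactly $r+1$ elements $s_{\eta_i}[0]<\cdots<s_{\eta_i}[r]$, and the local array $$\{\mathbf x\in[r]^d:\ \text{there is } f\in\Sigma \text{ with } \mathrm{sl}_{\eta_i}(f)=s_{\eta_i}[x_i]\text{ for all } i\}$$ is the redundant closure of a permutation array of rank $r$ and dimension $d$. -/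

import Mathlib

open Filter Topology

/-- A metric graph: a graph with vertex set `V` and edge set `E` (loops and multiple edges allowed),
together with a real interval `[0, len e]` of positive finite length for every edge `e`.
Finiteness of the graph is imposed by `[Finite V] [Finite E]` where needed. -/
structure MetricGraph (V E : Type*) where
  src : E → V
  tgt : E → V
  len : E → ℝ
  len_pos : ∀ e, 0 < len e

namespace MetricGraph

variable {V E : Type*}

/-- The points of the metric graph: the vertices, and the interior points of the edges. -/
inductive Point (Γ : MetricGraph V E) : Type _
  | vertex (v : V) : Point Γ
  | interior (e : E) (t : ℝ) (h0 : 0 < t) (h1 : t < Γ.len e) : Point Γ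

open Classical in
/-- The point at position `t ∈ [0, len e]` of the edge `e`; the two ends of the interval are glued
to the end vertices of `e`. -/
noncomputable def pt (Γ : MetricGraph V E) (e : E) (t : ℝ) : Γ.Point :=
  if h0 : t ≤ 0 then .vertex (Γ.src e)
  else if h1 : Γ.len e ≤ t then .vertex (Γ.tgt e)
  else .interior e t (not_le.mp h0) (not_le.mp h1)

/-- Tangent vectors of the metric graph: a position on an edge `e` together with a direction in
which one can move along `e` from that position. -/
inductive Tangent (Γ : MetricGraph V E) : Type _
  | forward (e : E) (t : ℝ) (h0 : 0 ≤ t) (h1 : t < Γ.len e) : Tangent Γ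
  | backward (e : E) (t : ℝ) (h0 : 0 < t) (h1 : t ≤ Γ.len e) : Tangent Γ

/-- The unit speed path that starts in the direction of a tangent vector. -/
noncomputable def Tangent.path {Γ : MetricGraph V E} : Γ.Tangent → ℝ → Γ.Point
  | .forward e t _ _, s => Γ.pt e (t + s)
  | .backward e t _ _, s => Γ.pt e (t - s)

/-- The base point of a tangent vector. -/
noncomputable def Tangent.base {Γ : MetricGraph V E} (η : Γ.Tangent) : Γ.Point := η.path 0

/-- The set `T_v(Γ)` of outgoing tangent vectors at `v`. -/
def tangentsAt (Γ : MetricGraph V E) (v : Γ.Point) : Set Γ.Tangent := {η | η.base = v}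

/-- `f` is continuous and piecewise linear with integer slopes: on every edge there is a finite set
`B` of breakpoints such that `f` is affine with an integer slope on each closed subinterval whose
interior avoids `B`. -/
def IsPL (Γ : MetricGraph V E) (f : Γ.Point → ℝ) : Prop :=
  ∀ e : E, ∃ B : Finset ℝ, ∀ a b : ℝ, 0 ≤ a → a < b → b ≤ Γ.len e →
    (∀ t ∈ Set.Ioo a b, t ∉ B) →
    ∃ m : ℤ, ∀ t ∈ Set.Icc a b, f (Γ.pt e t) = f (Γ.pt e a) + m * (t - a)

/-- `m` is the outgoing slope of `f` along `η`. -/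
def IsSlope {Γ : MetricGraph V E} (f : Γ.Point → ℝ) (η : Γ.Tangent) (m : ℤ) : Prop :=
  ∀ᶠ s in 𝓝[>] (0 : ℝ), f (η.path s) = f η.base + m * s

open Classical in
/-- The outgoing slope `sl_η(f)`. For piecewise linear `f` it exists and is unique, see
`IsPL.exists_isSlope` and `IsSlope.slope_eq`. -/
noncomputable def slope {Γ : MetricGraph V E} (f : Γ.Point → ℝ) (η : Γ.Tangent) : ℤ :=
  if h : ∃ m : ℤ, IsSlope f η m then h.choose else 0

theorem IsSlope.unique {Γ : MetricGraph V E} {f : Γ.Point → ℝ} {η : Γ.Tangent} {m n : ℤ}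
    (hm : IsSlope f η m) (hn : IsSlope f η n) : m = n := by
  obtain ⟨s, ⟨h1, h2⟩, hs⟩ := ((hm.and hn).and self_mem_nhdsWithin).exists
  have hs' : (0 : ℝ) < s := hs
  have : (m : ℝ) * s = n * s := by linarith
  exact_mod_cast mul_right_cancel₀ hs'.ne' this

theorem IsSlope.slope_eq {Γ : MetricGraph V E} {f : Γ.Point → ℝ} {η : Γ.Tangent} {m : ℤ}
    (hm : IsSlope f η m) : slope f η = m := by
  have h : ∃ m : ℤ, IsSlope f η m := ⟨m, hm⟩
  rw [slope, dif_pos h]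
  exact h.choose_spec.unique hm

theorem IsPL.exists_isSlope {Γ : MetricGraph V E} {f : Γ.Point → ℝ} (hf : Γ.IsPL f)
    (η : Γ.Tangent) : ∃ m : ℤ, IsSlope f η m := by
  have key : ∀ (B : Finset ℝ) (t : ℝ), ∀ᶠ s in 𝓝[≠] t, s ∉ B := by
    intro B t
    have h : (↑(B.erase t) : Set ℝ)ᶜ ∈ 𝓝 t :=
      (B.erase t).finite_toSet.isClosed.isOpen_compl.mem_nhds (by simp)
    filter_upwards [nhdsWithin_le_nhds h, self_mem_nhdsWithin] with s hs hst hsB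
    exact hs (Finset.mem_coe.2 (Finset.mem_erase.2 ⟨hst, hsB⟩))
  cases η with
  | forward e t h0 h1 =>
    obtain ⟨B, hB⟩ := hf e
    have h2 : ∀ᶠ s in 𝓝[>] t, s ∉ B :=
      (key B t).filter_mono (nhdsWithin_mono _ fun x hx => ne_of_gt hx)
    obtain ⟨u, hu, hu'⟩ := (mem_nhdsGT_iff_exists_Ioo_subset' h1).1 h2
    have hu0 : t < u := hu
    obtain ⟨m, hm⟩ := hB t (min u (Γ.len e)) h0 (lt_min hu0 h1) (min_le_right _ _)
      (fun s hs => hu' ⟨hs.1, hs.2.trans_le (min_le_left _ _)⟩)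
    refine ⟨m, ?_⟩
    have hpos : 0 < min u (Γ.len e) - t := sub_pos.2 (lt_min hu0 h1)
    filter_upwards [Ioo_mem_nhdsGT hpos] with s hs
    have := hm (t + s) ⟨by linarith [hs.1], by linarith [hs.2]⟩
    simpa [Tangent.base, Tangent.path] using this
  | backward e t h0 h1 =>
    obtain ⟨B, hB⟩ := hf e
    have h2 : ∀ᶠ s in 𝓝[<] t, s ∉ B :=
      (key B t).filter_mono (nhdsWithin_mono _ fun x hx => ne_of_lt hx)
    obtain ⟨u, hu, hu'⟩ := (mem_nhdsLT_iff_exists_Ioo_subset' h0).1 h2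
    have hu0 : u < t := hu
    have hlt : max u 0 < t := max_lt hu0 h0
    obtain ⟨m, hm⟩ := hB (max u 0) t (le_max_right _ _) hlt h1
      (fun s hs => hu' ⟨(le_max_left _ _).trans_lt hs.1, hs.2⟩)
    refine ⟨-m, ?_⟩
    filter_upwards [Ioo_mem_nhdsGT (sub_pos.2 hlt)] with s hs
    have e1 := hm (t - s) ⟨by linarith [hs.2], by linarith [hs.1]⟩
    have e2 := hm t ⟨hlt.le, le_rfl⟩
    simp only [Tangent.base, Tangent.path, sub_zero]
    push_cast
    linarith

/-- Every point of a finite metric graph has only finitely many tangent vectors, so the sum in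
`ord` below is a finite sum. -/
theorem finite_tangentsAt [Finite E] (Γ : MetricGraph V E) (v : Γ.Point) :
    (Γ.tangentsAt v).Finite := by
  let pos : Γ.Point → E → ℝ := fun p e => match p with
    | .vertex _ => 0
    | .interior _ t _ _ => t
  let pos' : Γ.Point → E → ℝ := fun p e => match p with
    | .vertex _ => Γ.len e
    | .interior _ t _ _ => t
  let g : Γ.Tangent → E × Bool := fun η => match η with
    | .forward e _ _ _ => (e, true)
    | .backward e _ _ _ => (e, false)
  have hf : ∀ e t h0 h1, pos (Tangent.base (Γ := Γ) (.forward e t h0 h1)) e = t := by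
    intro e t h0 h1
    simp only [Tangent.base, Tangent.path, add_zero, pt, pos]
    by_cases h : t ≤ 0
    · simp [le_antisymm h h0]
    · simp [h, not_le.2 h1]
  have hb : ∀ e t h0 h1, pos' (Tangent.base (Γ := Γ) (.backward e t h0 h1)) e = t := by
    intro e t h0 h1
    simp only [Tangent.base, Tangent.path, sub_zero, pt, pos']
    by_cases h : Γ.len e ≤ t
    · simp [not_le.2 h0, le_antisymm h h1]
    · simp [h, not_le.2 h0]
  refine Set.Finite.of_finite_image (f := g) (Set.toFinite _) ?_
  intro η hη ξ hξ h
  have hbase : η.base = ξ.base := Eq.trans hη (Eq.symm hξ)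
  cases η with
  | forward e t h0 h1 =>
    cases ξ with
    | forward e' t' h0' h1' =>
      obtain rfl : e = e' := congrArg Prod.fst h
      obtain rfl : t = t' := by rw [← hf e t h0 h1, hbase, hf]
      rfl
    | backward e' t' h0' h1' => exact absurd (congrArg Prod.snd h) (by simp [g])
  | backward e t h0 h1 =>
    cases ξ with
    | forward e' t' h0' h1' => exact absurd (congrArg Prod.snd h) (by simp [g])
    | backward e' t' h0' h1' =>
      obtain rfl : e = e' := congrArg Prod.fst h
      obtain rfl : t = t' := by rw [← hb e t h0 h1, hbase, hb]
      rfl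

/-- The order of vanishing `ord_v(f)`, that is, the coefficient of `div(f)` at `v`. -/
noncomputable def ord {Γ : MetricGraph V E} (f : Γ.Point → ℝ) (v : Γ.Point) : ℤ :=
  -∑ᶠ η : Γ.tangentsAt v, slope f η

/-- The complete linear series `R(D)`. -/
def completeLinearSeries (Γ : MetricGraph V E) (D : Γ.Point →₀ ℤ) : Set (Γ.Point → ℝ) :=
  {f | Γ.IsPL f ∧ ∀ v, 0 ≤ D v + ord f v}

/-- The set of tropical linear combinations `min {f₁ + a₁, …, fₙ + aₙ}`, `n ≥ 1`, of elements of
`S`. -/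
def tropicalSpan {X : Type*} (S : Set (X → ℝ)) : Set (X → ℝ) :=
  {θ | ∃ (T : Finset (X → ℝ)) (hT : T.Nonempty) (a : (X → ℝ) → ℝ), ↑T ⊆ S ∧
    ∀ p, θ p = T.inf' hT (fun f => f p + a f)}

/-- A set of functions is tropically dependent if real constants can be added to its elements such
that, at every point, the minimum is attained by at least two of them. -/
def TropicallyDependent {X : Type*} (S : Finset (X → ℝ)) : Prop :=
  ∃ a : (X → ℝ) → ℝ, ∀ p, ∃ f ∈ S, ∃ g ∈ S, f ≠ g ∧ f p + a f = g p + a g ∧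
    ∀ h ∈ S, f p + a f ≤ h p + a h

/-- `(D, L)` is a tropical linear series of rank `r`. -/
structure IsTropicalLinearSeries (Γ : MetricGraph V E) (D : Γ.Point →₀ ℤ) (r : ℕ)
    (L : Set (Γ.Point → ℝ)) : Prop where
  subset : L ⊆ Γ.completeLinearSeries D
  submodule : tropicalSpan L ⊆ L
  finitely_generated : ∃ S : Finset (Γ.Point → ℝ), L = tropicalSpan (↑S : Set (Γ.Point → ℝ))
  exists_div_ge : ∀ F : Γ.Point →₀ ℤ, 0 ≤ F → (F.sum fun _ n => n) = r →
    ∃ f ∈ L, ∀ v, F v ≤ ord f v + D v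
  dependent : ∀ S : Finset (Γ.Point → ℝ), ↑S ⊆ L → S.card = r + 2 → TropicallyDependent S

/-- `(D, L)` is a strongly recursive tropical linear series of rank `r`. -/
def IsStronglyRecursive (Γ : MetricGraph V E) (D : Γ.Point →₀ ℤ) (r : ℕ)
    (L : Set (Γ.Point → ℝ)) : Prop :=
  Γ.IsTropicalLinearSeries D r L ∧
  (0 < r → ∀ S : Finset (Γ.Point → ℝ), ↑S ⊆ L → S.card = r →
    ∃ L' ⊆ L, ↑S ⊆ L' ∧ IsStronglyRecursive Γ D (r - 1) L') ∧
  (∀ s₁ s₂ : ℕ, s₁ ≤ r → s₂ ≤ r → r + 2 ≤ s₁ + s₂ →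
    ∀ S₁ S₂ : Finset (Γ.Point → ℝ), ↑S₁ ⊆ L → ↑S₂ ⊆ L → S₁.card = s₁ → S₂.card = s₂ →
    ∃ L₁ ⊆ L, ∃ L₂ ⊆ L, ↑S₁ ⊆ L₁ ∧ ↑S₂ ⊆ L₂ ∧
      IsStronglyRecursive Γ D (s₁ - 1) L₁ ∧ IsStronglyRecursive Γ D (s₂ - 1) L₂ ∧
      ∃ L₃ ⊆ L₁ ∩ L₂, IsStronglyRecursive Γ D (s₁ + s₂ - r - 2) L₃)
termination_by r
decreasing_by all_goals omega

/-- The set `sl_η(L)` of slopes along `η` of the functions in `L`. -/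
def slopes {Γ : MetricGraph V E} (L : Set (Γ.Point → ℝ)) (η : Γ.Tangent) : Set ℤ :=
  {m | ∃ f ∈ L, slope f η = m}

/-- `m = s_η[i]`: the integer `m` is the `i`-th smallest element, counted from `0`, of the set
`sl_η(L)` of slopes. -/
def IsNthSlope {Γ : MetricGraph V E} (L : Set (Γ.Point → ℝ)) (η : Γ.Tangent) (i : ℕ) (m : ℤ) :
    Prop :=
  m ∈ slopes L η ∧ {n ∈ slopes L η | n < m}.encard = i

/-- The local array of `L` in `[r]^d`, with respect to tangent vectors `η₁, …, η_d`. -/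
def localArray {Γ : MetricGraph V E} (L : Set (Γ.Point → ℝ)) (r : ℕ) {d : ℕ}
    (η : Fin d → Γ.Tangent) : Set (Fin d → Fin (r + 1)) :=
  {x | ∃ f ∈ L, ∀ i, IsNthSlope L (η i) (x i) (slope f (η i))}

end MetricGraph

/-- Dot arrays in `[r]^d`, where `[r] = {0, 1, …, r}`. The order on `[r]^d` is the componentwise
order. -/
abbrev DotArray (r d : ℕ) : Type := Set (Fin d → Fin (r + 1))

namespace DotArray

variable {r d : ℕ}

/-- The principal subarray `P[x]`. -/
def principal (P : DotArray r d) (x : Fin d → Fin (r + 1)) : DotArray r d :=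
  {y | y ∈ P ∧ x ≤ y}

/-- The rank of `P` along the `i`-axis. -/
noncomputable def axisRank (P : DotArray r d) (i : Fin d) : ℤ :=
  ((fun x : Fin d → Fin (r + 1) => x i) '' P).ncard - 1

/-- `P` is rankable of rank `s`. -/
def HasRank (P : DotArray r d) (s : ℤ) : Prop := ∀ i, axisRank P i = s

/-- Every principal subarray of `P` is rankable. -/
def TotallyRankable (P : DotArray r d) : Prop := ∀ x, ∃ s : ℤ, HasRank (principal P x) s

/-- `x` is redundant: it is the meet of a set of at least two dotted positions, each of which has a
coordinate in common with `x`. -/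
def Redundant (P : DotArray r d) (x : Fin d → Fin (r + 1)) : Prop :=
  ∃ H : Finset (Fin d → Fin (r + 1)), ↑H ⊆ P ∧ 2 ≤ H.card ∧ (∀ y ∈ H, ∃ i, y i = x i) ∧
    IsGLB (↑H : Set (Fin d → Fin (r + 1))) x

/-- `P` is a permutation array of rank `r` and dimension `d`. -/
structure IsPermutationArray (P : DotArray r d) : Prop where
  totallyRankable : TotallyRankable P
  hasRank : HasRank P r
  not_redundant : ∀ x ∈ P, ¬ Redundant P x

/-- The redundant closure `P ∪ R(P)`. -/
def redundantClosure (P : DotArray r d) : DotArray r d := P ∪ {x | Redundant P x}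

end DotArray

/-!
Let `A` be a totally rankable dot array that is closed under meets. If a position of `A` shares one
coordinate with a larger position of `A`, then it shares each of its coordinates with a larger
position: otherwise passing to a smaller principal subarray would lower the rank along one axis but
not along another. So a position outside the core of `A`, the set of positions that share no
coordinate with a larger one, is the meet of positions of the core sharing its coordinates. This
makes the core a permutation array with redundant closure `A`, and it remains to see that the local
array is closed under meets, totally rankable and of rank `r`.

* Meets: after translation two functions agree at `v`, and the slopes of their minimum are the
  minima of their slopes.
* Number of slopes: a tropical dependence makes two germs along `η` coincide, so functions with
  distinct slopes along `η` are independent and there are at most `r + 1` slopes. Conversely, near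
  the base of `η` a function of the series whose divisor contains `r` given points is a minimum of
  affine functions with `r` breakpoints, and its slopes are slopes of generators.
* Total rankability: let `n + 1` functions have slopes at least `c k` along each `η k`, and distinct
  slopes along some `η i`; they lie in a subseries of rank `n`. They are dependent with any further
  function `g` of it, so `g` takes part in the minimum at `v` and has slopes at least `c k` too.
  As the subseries has `n + 1` slopes along each `η j`, at least as many slopes occur along `η j`
  under the bounds `c` as along `η i`.
-/

namespace DotArray

variable {r d : ℕ}

theorem principal_zero (A : DotArray r d) : principal A 0 = A := by
  ext x
  simp only [principal, Set.mem_ofPred_eq, and_iff_left_iff_imp]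
  exact fun _ i => Fin.zero_le _

theorem principal_update_succ (A : DotArray r d) {x : Fin d → Fin (r + 1)} {j : Fin d}
    (hj : ¬ IsMax (x j)) :
    principal A (Function.update x j (Order.succ (x j))) = {z ∈ principal A x | x j < z j} := by
  ext z
  simp only [principal, Set.mem_ofPred_eq, update_le_iff, Order.succ_le_iff_of_not_isMax hj,
    and_assoc, and_congr_right_iff]
  refine fun _ => ⟨fun ⟨hlt, hle⟩ => ⟨fun k => ?_, hlt⟩, fun ⟨hle, hlt⟩ => ⟨hlt, fun k _ => hle k⟩⟩
  obtain rfl | hk := eq_or_ne k j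
  exacts [hlt.le, hle k hk]

theorem totallyRankable_iff_ncard_image_eq {A : DotArray r d} :
    TotallyRankable A ↔ ∀ x (i j : Fin d),
      ((· i) '' principal A x).ncard = ((· j) '' principal A x).ncard := by
  refine forall_congr' fun x => ⟨fun ⟨s, hs⟩ i j => ?_, fun h => ?_⟩
  · have hij : axisRank (principal A x) i = axisRank (principal A x) j := (hs i).trans (hs j).symm
    simpa [axisRank] using hij
  · obtain hd | ⟨⟨i⟩⟩ := isEmpty_or_nonempty (Fin d)
    · exact ⟨0, fun i => hd.elim i⟩
    · exact ⟨axisRank (principal A x) i, fun j => by rw [axisRank, h j i, axisRank]⟩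

/-- The positions of `A` that share no coordinate with a larger position of `A`. For a totally
rankable array closed under meets, this is the permutation array whose redundant closure it is. -/
def core (A : DotArray r d) : DotArray r d :=
  {x | x ∈ A ∧ ∀ y ∈ A, x ≤ y → (∃ i, y i = x i) → y = x}

theorem core_subset (A : DotArray r d) : core A ⊆ A := fun _ hx => hx.1

theorem not_redundant_core {A : DotArray r d} {x : Fin d → Fin (r + 1)} (hx : x ∈ core A) :
    ¬ Redundant (core A) x := by
  rintro ⟨H, hH, hcard, hshare, hglb⟩
  obtain ⟨y, hy, hyx⟩ := Finset.exists_mem_ne hcard x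
  exact hyx (hx.2 y (core_subset A (hH hy)) (hglb.1 hy) (hshare y hy))

theorem redundantClosure_subset {A P : DotArray r d} (hA : InfClosed A) (hPA : P ⊆ A) :
    redundantClosure P ⊆ A := by
  rintro x (hx | ⟨H, hH, hcard, -, hglb⟩)
  · exact hPA hx
  · have hne : H.Nonempty := Finset.card_pos.1 (by lia)
    rw [hglb.unique (Finset.isGLB_inf' hne)]
    exact hA.finsetInf'_mem hne fun y hy => hPA (hH hy)

namespace TotallyRankable

variable {A : DotArray r d} {x : Fin d → Fin (r + 1)}

/-- If no larger position agreed with `x` at `j`, then raising `x j` by one would remove only `x`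
from the principal subarray, and so lower its rank along the `j`-axis but not along the `i`-axis. -/
theorem exists_gt_apply_eq (hA : TotallyRankable A) (hx : x ∈ A) {y : Fin d → Fin (r + 1)}
    (hy : y ∈ A) (hxy : x < y) {i : Fin d} (hi : y i = x i) (j : Fin d) :
    ∃ z ∈ A, x < z ∧ z j = x j := by
  by_contra! hne
  have hlt : ∀ z ∈ A, x < z → x j < z j := fun z hz hxz =>
    lt_of_le_of_ne (hxz.le j) (hne z hz hxz).symm
  have herase : principal A (Function.update x j (Order.succ (x j))) = principal A x \ {x} := by
    rw [principal_update_succ A (hlt y hy hxy).not_isMax]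
    ext z
    refine and_congr_right fun hz => ⟨fun hxz h => ?_, fun hzx => ?_⟩
    · exact hxz.ne' (congrFun h j)
    · exact hlt z hz.1 (lt_of_le_of_ne hz.2 (Ne.symm hzx))
  have hxmem : x ∈ principal A x := ⟨hx, le_rfl⟩
  have hi' : (· i) '' (principal A x \ {x}) = (· i) '' principal A x := by
    refine (Set.image_mono Set.sdiff_subset).antisymm ?_
    rintro _ ⟨z, hz, rfl⟩
    obtain rfl | hzx := eq_or_ne z x
    · exact ⟨y, ⟨⟨hy, hxy.le⟩, hxy.ne'⟩, hi⟩
    · exact ⟨z, ⟨hz, hzx⟩, rfl⟩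
  have hj' : (· j) '' (principal A x \ {x}) ⊂ (· j) '' principal A x := by
    refine Set.ssubset_iff_exists.2 ⟨Set.image_mono Set.sdiff_subset, x j, ⟨x, hxmem, rfl⟩, ?_⟩
    rintro ⟨z, ⟨hz, hzx⟩, hzj⟩
    exact hne z hz.1 (lt_of_le_of_ne hz.2 (Ne.symm hzx)) hzj
  have hrank := totallyRankable_iff_ncard_image_eq.1 hA
  have hrank' := hrank (Function.update x j (Order.succ (x j))) i j
  rw [herase, hi', hrank x i j] at hrank'
  exact (Set.ncard_lt_ncard hj').ne' hrank'

theorem exists_core_ge (hA : TotallyRankable A) (hx : x ∈ A) (i : Fin d) :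
    ∃ y ∈ core A, x ≤ y ∧ y i = x i := by
  induction x using (wellFounded_gt (α := Fin d → Fin (r + 1))).induction with
  | _ x ih =>
    by_cases hc : x ∈ core A
    · exact ⟨x, hc, le_rfl, rfl⟩
    · simp only [core, Set.mem_ofPred_eq, not_and, not_forall] at hc
      obtain ⟨y, hy, hxy, ⟨k, hk⟩, hne⟩ := hc hx
      obtain ⟨z, hz, hxz, hzi⟩ :=
        hA.exists_gt_apply_eq hx hy (lt_of_le_of_ne hxy (Ne.symm hne)) hk i
      obtain ⟨w, hw, hzw, hwi⟩ := ih z hxz hz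
      exact ⟨w, hw, hxz.le.trans hzw, hwi.trans hzi⟩

theorem axisRank_principal_core (hA : TotallyRankable A) (x : Fin d → Fin (r + 1)) (i : Fin d) :
    axisRank (principal (core A) x) i = axisRank (principal A x) i := by
  have himage : (· i) '' principal (core A) x = (· i) '' principal A x := by
    apply Set.Subset.antisymm
    · exact Set.image_mono fun y hy => ⟨core_subset A hy.1, hy.2⟩
    · rintro _ ⟨y, ⟨hy, hxy⟩, rfl⟩
      obtain ⟨z, hz, hyz, hzi⟩ := hA.exists_core_ge hy i
      exact ⟨z, ⟨hz, hxy.trans hyz⟩, hzi⟩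
  rw [axisRank, himage, axisRank]

theorem isPermutationArray_core (hA : TotallyRankable A) (hr : HasRank A r) :
    IsPermutationArray (core A) where
  totallyRankable x := by
    obtain ⟨s, hs⟩ := hA x
    exact ⟨s, fun i => (hA.axisRank_principal_core x i).trans (hs i)⟩
  hasRank i := by simpa only [principal_zero, hr i] using hA.axisRank_principal_core 0 i
  not_redundant _ hx := not_redundant_core hx

theorem redundant_core_of_notMem (hA : TotallyRankable A) (hx : x ∈ A) (hc : x ∉ core A) :
    Redundant (core A) x := by
  classical
  choose p hp hxp hpi using fun i => hA.exists_core_ge hx i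
  have hpx : ∀ i, p i ≠ x := fun i h => hc (h ▸ hp i)
  obtain ⟨k⟩ : Nonempty (Fin d) := by
    simp only [core, Set.mem_ofPred_eq, not_and, not_forall] at hc
    obtain ⟨-, -, -, ⟨k, -⟩, -⟩ := hc hx
    exact ⟨k⟩
  refine ⟨Finset.univ.image p, by simpa [Set.range_subset_iff] using hp, ?_,
    by simpa using fun i => ⟨i, hpi i⟩, ?_⟩
  · obtain ⟨i, hi⟩ := Function.ne_iff.1 (hpx k)
    refine Finset.one_lt_card.2 ⟨p k, by simp, p i, by simp, fun h => hi ?_⟩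
    rw [h, hpi]
  · refine ⟨by simpa [lowerBounds] using hxp, fun z hz i => ?_⟩
    rw [← hpi i]
    exact hz (by simp) i

theorem redundantClosure_core (hA : TotallyRankable A) (hinf : InfClosed A) :
    redundantClosure (core A) = A := by
  refine (redundantClosure_subset hinf (core_subset A)).antisymm fun x hx => ?_
  by_cases hc : x ∈ core A
  · exact Or.inl hc
  · exact Or.inr (hA.redundant_core_of_notMem hx hc)

end TotallyRankable

end DotArray

theorem nonempty_finOrderIso_of_encard_eq {α : Type*} [LinearOrder α] {s : Set α} {k : ℕ}
    (h : s.encard = k) : Nonempty (Fin k ≃o s) := by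
  lift s to Finset α using Set.finite_of_encard_eq_coe h
  rw [Set.encard_coe_eq_coe_finsetCard, Nat.cast_inj] at h
  exact ⟨s.orderIsoOfFin h⟩

theorem encard_lt_finOrderIso {α : Type*} [Preorder α] {s : Set α} {k : ℕ} (e : Fin k ≃o s)
    (i : Fin k) : {n ∈ s | n < e i}.encard = i := by
  have himage : {n ∈ s | n < e i} = (fun j => (e j : α)) '' Set.Iio i := by
    ext n
    constructor
    · rintro ⟨hn, hlt⟩
      exact ⟨e.symm ⟨n, hn⟩, e.symm_apply_lt.2 hlt, by simp⟩
    · rintro ⟨j, hj, rfl⟩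
      exact ⟨(e j).2, e.lt_iff_lt.2 hj⟩
  have hinj : Function.Injective fun j => (e j : α) := Subtype.val_injective.comp e.injective
  rw [himage, hinj.encard_image, ← Finset.coe_Iio, Set.encard_coe_eq_coe_finsetCard, Fin.card_Iio]

theorem exists_finset_injOn_of_le_encard_image {α β : Type*} {f : α → β} {s : Set α} {k : ℕ}
    (h : k ≤ (f '' s).encard) :
    ∃ T : Finset α, ↑T ⊆ s ∧ T.card = k ∧ Set.InjOn f T := by
  obtain ⟨u, hus, hu⟩ := Set.exists_subset_bijOn s f
  rw [← hu.image_eq, hu.injOn.encard_image] at h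
  obtain ⟨T, hTu, hT⟩ := Set.exists_subset_encard_eq h
  lift T to Finset α using Set.finite_of_encard_eq_coe hT
  rw [Set.encard_coe_eq_coe_finsetCard, Nat.cast_inj] at hT
  exact ⟨T, hTu.trans hus, hT, hu.injOn.mono hTu⟩

section AffineFunctions

variable {𝕜 ι : Type*} [Field 𝕜] [LinearOrder 𝕜] [IsStrictOrderedRing 𝕜]

theorem eventually_affine_lt_of_lt [TopologicalSpace 𝕜] [OrderTopology 𝕜] {A B : 𝕜} (h : A < B)
    (m n : 𝕜) : ∀ᶠ s in 𝓝[>] (0 : 𝕜), A + m * s < B + n * s := by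
  have hA : Tendsto (fun s : 𝕜 => A + m * s) (𝓝 0) (𝓝 (A + m * 0)) :=
    Continuous.tendsto (by fun_prop) 0
  have hB : Tendsto (fun s : 𝕜 => B + n * s) (𝓝 0) (𝓝 (B + n * 0)) :=
    Continuous.tendsto (by fun_prop) 0
  exact (hA.eventually_lt hB (by simpa using h)).filter_mono nhdsWithin_le_nhds

theorem eventually_affine_le_iff [TopologicalSpace 𝕜] [OrderTopology 𝕜] (A B m n : 𝕜) :
    ∀ᶠ s in 𝓝[>] (0 : 𝕜), A + m * s ≤ B + n * s ↔ A < B ∨ A = B ∧ m ≤ n := by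
  obtain h | rfl | h := lt_trichotomy A B
  · filter_upwards [eventually_affine_lt_of_lt h m n] with s hs
    simp [h, hs.le]
  · filter_upwards [self_mem_nhdsWithin] with s hs
    simp [mul_le_mul_iff_left₀ (Set.mem_Ioi.1 hs)]
  · filter_upwards [eventually_affine_lt_of_lt h n m] with s hs
    simp [h.not_gt, h.ne', hs.not_ge]

theorem slope_le_of_affine_le_of_affine_le {A B m n p q : 𝕜} (hpq : p < q)
    (hp : A + m * p ≤ B + n * p) (hq : B + n * q ≤ A + m * q) : n ≤ m := by
  refine le_of_mul_le_mul_right ?_ (sub_pos.2 hpq)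
  linarith

/-- A minimum of affine functions is concave, so each of its breakpoints makes its slope drop. -/
theorem card_breakpoints_lt_card_slopes [DecidableEq 𝕜] {T : Finset ι} (hT : T.Nonempty)
    (c m : ι → 𝕜) {Q : Finset 𝕜}
    (hQ : ∀ p ∈ Q, ∃ f ∈ T, ∃ g ∈ T, m f < m g ∧
      ∀ h ∈ T, c f + m f * p ≤ c h + m h * p ∧ c g + m g * p ≤ c h + m h * p) :
    Q.card < (T.image m).card := by
  obtain ⟨top, htop, hle⟩ := T.exists_max_image m hT
  have : Nonempty ι := ⟨top⟩
  choose! f hf g hg hfg hmin using hQ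
  have hanti : StrictAntiOn (fun p => m (f p)) Q := fun p hp q hq hpq => (hfg q hq).trans_le <|
    slope_le_of_affine_le_of_affine_le hpq (hmin p hp _ (hg q hq)).1 (hmin q hq _ (hf p hp)).2
  have hmaps : Set.MapsTo (fun p => m (f p)) Q ((T.image m).erase (m top)) := fun p hp => by
    have hne : m (f p) ≠ m top := ((hfg p hp).trans_le (hle _ (hg p hp))).ne
    simpa [hne] using ⟨f p, hf p hp, rfl⟩
  exact (Finset.card_le_card_of_injOn _ hmaps hanti.injOn).trans_lt
    (Finset.card_erase_lt_of_mem (Finset.mem_image_of_mem m htop))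

end AffineFunctions

namespace MetricGraph

variable {V E : Type*} {Γ : MetricGraph V E}

theorem pt_eq_interior {e : E} {t : ℝ} (h0 : 0 < t) (h1 : t < Γ.len e) :
    Γ.pt e t = .interior e t h0 h1 := by
  rw [pt, dif_neg h0.not_ge, dif_neg h1.not_ge]

theorem tangentsAt_interior {e : E} {t : ℝ} (h0 : 0 < t) (h1 : t < Γ.len e) :
    Γ.tangentsAt (.interior e t h0 h1) = {.forward e t h0.le h1, .backward e t h0 h1.le} := by
  ext η
  simp only [tangentsAt, Set.mem_ofPred_eq, Set.mem_insert_iff, Set.mem_singleton_iff,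
    Tangent.base]
  constructor
  · intro hbase
    cases η with
    | forward e' t' h0' h1' =>
      simp only [Tangent.path, pt, add_zero] at hbase
      split_ifs at hbase
      cases hbase
      exact Or.inl rfl
    | backward e' t' h0' h1' =>
      simp only [Tangent.path, pt, sub_zero] at hbase
      split_ifs at hbase
      cases hbase
      exact Or.inr rfl
  · rintro (rfl | rfl) <;> simp [Tangent.path, pt_eq_interior h0 h1]

theorem ord_pt (f : Γ.Point → ℝ) {e : E} {t : ℝ} (h0 : 0 < t) (h1 : t < Γ.len e) :
    ord f (Γ.pt e t) = -(slope f (.forward e t h0.le h1) + slope f (.backward e t h0 h1.le)) := by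
  rw [ord, pt_eq_interior h0 h1, finsum_set_coe_eq_finsum_mem (f := fun η => slope f η),
    tangentsAt_interior, finsum_mem_pair (by simp)]

namespace Tangent

/-- The length of the edge that remains ahead of a tangent vector: its path runs through interior
points of the edge for exactly this long. -/
def length : Γ.Tangent → ℝ
  | .forward e t _ _ => Γ.len e - t
  | .backward _ t _ _ => t

theorem length_pos (η : Γ.Tangent) : 0 < η.length := by
  cases η with
  | forward e t h0 h1 => exact sub_pos.2 h1
  | backward e t h0 h1 => exact h0

theorem injOn_path (η : Γ.Tangent) : Set.InjOn η.path (Set.Ioo 0 η.length) := by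
  intro s hs s' hs' h
  cases η with
  | forward e t h0 h1 =>
    simp only [length, Set.mem_Ioo] at hs hs'
    rw [path, path, pt_eq_interior (by linarith) (by linarith),
      pt_eq_interior (by linarith) (by linarith), Point.interior.injEq] at h
    linarith [h.2]
  | backward e t h0 h1 =>
    simp only [length, Set.mem_Ioo] at hs hs'
    rw [path, path, pt_eq_interior (by linarith) (by linarith),
      pt_eq_interior (by linarith) (by linarith), Point.interior.injEq] at h
    linarith [h.2]

theorem exists_ahead_behind (η : Γ.Tangent) {s : ℝ} (hs : s ∈ Set.Ioo 0 η.length) :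
    ∃ ahead behind : Γ.Tangent, (∀ u, ahead.path u = η.path (s + u)) ∧
      (∀ u, behind.path u = η.path (s - u)) ∧
      ∀ f, ord f (η.path s) = -(slope f ahead + slope f behind) := by
  cases η with
  | forward e t h0 h1 =>
    simp only [length, Set.mem_Ioo] at hs
    exact ⟨.forward e (t + s) (by linarith) (by linarith),
      .backward e (t + s) (by linarith) (by linarith),
      fun u => by simp only [path, add_assoc], fun u => by simp only [path, add_sub_assoc],
      fun f => ord_pt f _ _⟩
  | backward e t h0 h1 =>
    simp only [length, Set.mem_Ioo] at hs
    exact ⟨.backward e (t - s) (by linarith) (by linarith),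
      .forward e (t - s) (by linarith) (by linarith),
      fun u => by simp only [path, sub_sub], fun u => by simp only [path, sub_add],
      fun f => by rw [path, ord_pt, add_comm]⟩

theorem eventually_path_notMem (η : Γ.Tangent) {F : Set Γ.Point} (hF : F.Finite) :
    ∀ᶠ s in 𝓝[>] (0 : ℝ), η.path s ∉ F := by
  have hfin : (Set.Ioo 0 η.length ∩ η.path ⁻¹' F).Finite :=
    Set.Finite.of_finite_image (f := η.path)
      (hF.subset (Set.image_subset_iff.2 Set.inter_subset_right))
      (η.injOn_path.mono Set.inter_subset_left)
  have hnhds : (Set.Ioo 0 η.length ∩ η.path ⁻¹' F)ᶜ ∈ 𝓝 (0 : ℝ) :=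
    hfin.isClosed.isOpen_compl.mem_nhds (by simp)
  filter_upwards [Ioo_mem_nhdsGT η.length_pos, nhdsWithin_le_nhds hnhds] with s hs hs' hsF
  exact hs' ⟨hs, hsF⟩

end Tangent

theorem IsPL.isSlope_slope {f : Γ.Point → ℝ} (hf : Γ.IsPL f) (η : Γ.Tangent) :
    IsSlope f η (slope f η) := by
  obtain ⟨m, hm⟩ := hf.exists_isSlope η
  rwa [hm.slope_eq]

theorem IsSlope.add_const {f : Γ.Point → ℝ} {η : Γ.Tangent} {m : ℤ} (hf : IsSlope f η m) (c : ℝ) :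
    IsSlope (fun p => f p + c) η m := by
  filter_upwards [hf] with s hs
  rw [hs]
  ring

theorem IsSlope.inf {f g : Γ.Point → ℝ} {η : Γ.Tangent} {m n : ℤ} (hf : IsSlope f η m)
    (hg : IsSlope g η n) (hfg : f η.base = g η.base) : IsSlope (f ⊓ g) η (m ⊓ n) := by
  filter_upwards [hf, hg, self_mem_nhdsWithin] with s hfs hgs hs
  simp only [Pi.inf_apply, hfs, hgs, hfg, inf_idem, min_add_add_left, Int.cast_min,
    min_mul_of_nonneg _ _ (Set.mem_Ioi.1 hs).le]

/-- The first-order germ of `f + a` along `η`: its value at the base of `η` and its slope. The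
lexicographic order on germs is the order of the functions at points of the path close to the
base. -/
noncomputable def germ (f : Γ.Point → ℝ) (a : ℝ) (η : Γ.Tangent) : ℝ ×ₗ ℤ :=
  toLex (f η.base + a, slope f η)

section Germ

variable {f g : Γ.Point → ℝ} {a b : ℝ} {η : Γ.Tangent}

theorem germ_eq_germ_iff :
    germ f a η = germ g b η ↔ f η.base + a = g η.base + b ∧ slope f η = slope g η := by
  simp [germ]

theorem add_le_add_of_germ_le_germ (h : germ f a η ≤ germ g b η) :
    f η.base + a ≤ g η.base + b :=
  Prod.Lex.monotone_fst _ _ h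

theorem slope_le_slope_of_germ_le_germ (h : germ f a η ≤ germ g b η)
    (hgf : g η.base + b ≤ f η.base + a) : slope f η ≤ slope g η :=
  (Prod.Lex.toLex_le_toLex.1 h).elim (fun hlt => absurd hlt hgf.not_gt) And.right

theorem eventually_add_le_add_iff_germ_le_germ (hf : Γ.IsPL f) (hg : Γ.IsPL g) (a b : ℝ)
    (η : Γ.Tangent) :
    ∀ᶠ s in 𝓝[>] (0 : ℝ), f (η.path s) + a ≤ g (η.path s) + b ↔ germ f a η ≤ germ g b η := by
  filter_upwards [hf.isSlope_slope η, hg.isSlope_slope η,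
    eventually_affine_le_iff (f η.base + a) (g η.base + b) (slope f η) (slope g η)]
    with s hfs hgs hs
  rw [hfs, hgs, add_right_comm, add_right_comm _ _ b, hs, germ, germ, Prod.Lex.toLex_le_toLex,
    Int.cast_le]

end Germ

theorem eventually_forall_add_le_add_iff_germ_le_germ {S : Finset (Γ.Point → ℝ)}
    (hS : ∀ f ∈ S, Γ.IsPL f) (a : (Γ.Point → ℝ) → ℝ) (η : Γ.Tangent) :
    ∀ᶠ s in 𝓝[>] (0 : ℝ), ∀ f ∈ S, ∀ g ∈ S,
      f (η.path s) + a f ≤ g (η.path s) + a g ↔ germ f (a f) η ≤ germ g (a g) η := by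
  simp only [Filter.eventually_all_finset]
  exact fun f hf g hg => eventually_add_le_add_iff_germ_le_germ (hS f hf) (hS g hg) _ _ η

theorem TropicallyDependent.exists_germ_eq_germ {S : Finset (Γ.Point → ℝ)}
    (hdep : TropicallyDependent S) (hS : ∀ f ∈ S, Γ.IsPL f) :
    ∃ a : (Γ.Point → ℝ) → ℝ, ∀ η : Γ.Tangent, ∃ f ∈ S, ∃ g ∈ S, f ≠ g ∧
      germ f (a f) η = germ g (a g) η ∧ ∀ h ∈ S, germ f (a f) η ≤ germ h (a h) η := by
  obtain ⟨a, ha⟩ := hdep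
  refine ⟨a, fun η => ?_⟩
  obtain ⟨s, hs⟩ := (eventually_forall_add_le_add_iff_germ_le_germ hS a η).exists
  obtain ⟨f, hf, g, hg, hfg, heq, hmin⟩ := ha (η.path s)
  exact ⟨f, hf, g, hg, hfg,
    ((hs f hf g hg).1 heq.le).antisymm ((hs g hg f hf).1 heq.ge),
    fun h hh => (hs f hf h hh).1 (hmin h hh)⟩

theorem not_tropicallyDependent_of_injOn_slope {S : Finset (Γ.Point → ℝ)}
    (hS : ∀ f ∈ S, Γ.IsPL f) {η : Γ.Tangent} (hinj : Set.InjOn (slope · η) S) :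
    ¬ TropicallyDependent S := by
  intro hdep
  obtain ⟨a, ha⟩ := hdep.exists_germ_eq_germ hS
  obtain ⟨f, hf, g, hg, hne, hgerm, -⟩ := ha η
  exact hne (hinj hf hg (germ_eq_germ_iff.1 hgerm).2)

/-- Along `η` two functions attain the minimum, and as the slopes on `S` are distinct, one of them
is `g`. So `g` attains the minimum at the common base, and along `ξ` a function of `S` does so with
minimal slope. -/
theorem exists_slope_le_of_tropicallyDependent_insert [DecidableEq (Γ.Point → ℝ)]
    {S : Finset (Γ.Point → ℝ)} {g : Γ.Point → ℝ} (hPL : ∀ f ∈ insert g S, Γ.IsPL f)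
    {η ξ : Γ.Tangent} (hinj : Set.InjOn (slope · η) S)
    (hdep : TropicallyDependent (insert g S)) (hξ : ξ.base = η.base) :
    ∃ f ∈ S, slope f ξ ≤ slope g ξ := by
  obtain ⟨a, ha⟩ := hdep.exists_germ_eq_germ hPL
  have hmin : ∀ h ∈ insert g S, g η.base + a g ≤ h η.base + a h := by
    intro h hh
    apply add_le_add_of_germ_le_germ
    obtain ⟨f, hf, f', hf', hne, hgerm, hle⟩ := ha η
    obtain rfl | hfS := Finset.mem_insert.1 hf
    · exact hle h hh
    obtain rfl | hfS' := Finset.mem_insert.1 hf'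
    · exact hgerm ▸ hle h hh
    · exact absurd (hinj hfS hfS' (germ_eq_germ_iff.1 hgerm).2) hne
  obtain ⟨f, hf, f', hf', hne, hgerm, hle⟩ := ha ξ
  obtain ⟨f₀, hf₀, hle₀⟩ : ∃ f₀ ∈ S, germ f₀ (a f₀) ξ ≤ germ g (a g) ξ := by
    have hfg := hle g (Finset.mem_insert_self g S)
    obtain rfl | hfS := Finset.mem_insert.1 hf
    · exact ⟨f', Finset.mem_of_mem_insert_of_ne hf' hne.symm, hgerm.ge⟩
    · exact ⟨f, hfS, hfg⟩
  refine ⟨f₀, hf₀, slope_le_slope_of_germ_le_germ hle₀ ?_⟩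
  rw [hξ]
  exact hmin f₀ (Finset.mem_insert_of_mem hf₀)

theorem exists_germ_eq_germ_of_eq_inf' {T : Finset (Γ.Point → ℝ)} (hT : T.Nonempty)
    (hPL : ∀ f ∈ T, Γ.IsPL f) {a : (Γ.Point → ℝ) → ℝ} {θ : Γ.Point → ℝ} (hθPL : Γ.IsPL θ)
    (hθ : ∀ p, θ p = T.inf' hT fun f => f p + a f) (η : Γ.Tangent) :
    ∃ f ∈ T, germ θ 0 η = germ f (a f) η := by
  have hev : ∀ᶠ s in 𝓝[>] (0 : ℝ), ∀ f ∈ T,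
      θ (η.path s) + 0 = f (η.path s) + a f → germ θ 0 η = germ f (a f) η := by
    rw [Filter.eventually_all_finset]
    intro f hf
    filter_upwards [eventually_add_le_add_iff_germ_le_germ hθPL (hPL f hf) 0 (a f) η,
      eventually_add_le_add_iff_germ_le_germ (hPL f hf) hθPL (a f) 0 η] with s hle hge heq
    exact (hle.1 heq.le).antisymm (hge.1 heq.ge)
  obtain ⟨s, hs⟩ := hev.exists
  obtain ⟨f, hf, hfs⟩ := Finset.exists_mem_eq_inf' hT fun f => f (η.path s) + a f
  exact ⟨f, hf, hs f hf (by rw [add_zero, hθ, hfs])⟩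

/-- `f` is affine on the initial segment of length `ε` in direction `η`. -/
def IsAffineAlong (f : Γ.Point → ℝ) (η : Γ.Tangent) (ε : ℝ) : Prop :=
  ∀ s ∈ Set.Ioo 0 ε, f (η.path s) = f η.base + slope f η * s

namespace IsAffineAlong

variable {f : Γ.Point → ℝ} {η τ : Γ.Tangent} {ε s : ℝ}

theorem slope_ahead (hf : IsAffineAlong f η ε) (hs : s ∈ Set.Ioo 0 ε)
    (hτ : ∀ u, τ.path u = η.path (s + u)) : slope f τ = slope f η := by
  apply IsSlope.slope_eq
  filter_upwards [Ioo_mem_nhdsGT (sub_pos.2 hs.2)] with u hu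
  rw [Tangent.base, hτ, hτ, add_zero, hf s hs,
    hf (s + u) ⟨by linarith [hs.1, hu.1], by linarith [hu.2]⟩]
  ring

theorem slope_behind (hf : IsAffineAlong f η ε) (hs : s ∈ Set.Ioo 0 ε)
    (hτ : ∀ u, τ.path u = η.path (s - u)) : slope f τ = -slope f η := by
  apply IsSlope.slope_eq
  filter_upwards [Ioo_mem_nhdsGT hs.1] with u hu
  rw [Tangent.base, hτ, hτ, sub_zero, hf s hs,
    hf (s - u) ⟨by linarith [hu.2], by linarith [hs.2, hu.1]⟩]
  push_cast
  ring

end IsAffineAlong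

theorem exists_forall_isAffineAlong {S : Finset (Γ.Point → ℝ)} (hS : ∀ f ∈ S, Γ.IsPL f)
    {F : Set Γ.Point} (hF : F.Finite) (η : Γ.Tangent) :
    ∃ ε, 0 < ε ∧ ε ≤ η.length ∧ (∀ f ∈ S, IsAffineAlong f η ε) ∧
      ∀ s ∈ Set.Ioo 0 ε, η.path s ∉ F := by
  have hlin : ∀ᶠ s in 𝓝[>] (0 : ℝ), ∀ f ∈ S, f (η.path s) = f η.base + slope f η * s := by
    rw [Filter.eventually_all_finset]
    exact fun f hf => (hS f hf).isSlope_slope η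
  obtain ⟨ε, hε, hsub⟩ :=
    mem_nhdsGT_iff_exists_Ioo_subset.1 (hlin.and (η.eventually_path_notMem hF))
  have hmono : ∀ s ∈ Set.Ioo 0 (min ε η.length), s ∈ Set.Ioo 0 ε := fun s hs =>
    ⟨hs.1, hs.2.trans_le (min_le_left _ _)⟩
  exact ⟨min ε η.length, lt_min hε η.length_pos, min_le_right _ _,
    fun f hf s hs => (hsub (hmono s hs)).1 f hf, fun s hs => (hsub (hmono s hs)).2⟩

/-- Of the functions attaining the minimum at the point, the slope of `θ` ahead is the smallest
slope and the slope of `θ` behind is minus the largest one; a positive order makes them differ. -/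
theorem exists_slope_lt_slope_of_ord_pos {T : Finset (Γ.Point → ℝ)} (hT : T.Nonempty)
    (hPL : ∀ f ∈ T, Γ.IsPL f) {a : (Γ.Point → ℝ) → ℝ} {θ : Γ.Point → ℝ} (hθPL : Γ.IsPL θ)
    (hθ : ∀ p, θ p = T.inf' hT fun f => f p + a f) {η : Γ.Tangent} {ε s : ℝ}
    (hε : ε ≤ η.length) (haff : ∀ f ∈ T, IsAffineAlong f η ε) (hs : s ∈ Set.Ioo 0 ε)
    (hord : 0 < ord θ (η.path s)) :
    ∃ f ∈ T, ∃ g ∈ T, slope f η < slope g η ∧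
      θ (η.path s) = f (η.path s) + a f ∧ θ (η.path s) = g (η.path s) + a g := by
  obtain ⟨ahead, behind, hahead, hbehind, hordθ⟩ :=
    η.exists_ahead_behind ⟨hs.1, hs.2.trans_le hε⟩
  obtain ⟨f, hf, hfgerm⟩ := exists_germ_eq_germ_of_eq_inf' hT hPL hθPL hθ ahead
  obtain ⟨g, hg, hggerm⟩ := exists_germ_eq_germ_of_eq_inf' hT hPL hθPL hθ behind
  obtain ⟨hfval, hfslope⟩ := germ_eq_germ_iff.1 hfgerm
  obtain ⟨hgval, hgslope⟩ := germ_eq_germ_iff.1 hggerm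
  rw [(haff f hf).slope_ahead hs hahead] at hfslope
  rw [(haff g hg).slope_behind hs hbehind] at hgslope
  rw [Tangent.base, hahead, add_zero, add_zero] at hfval
  rw [Tangent.base, hbehind, sub_zero, add_zero] at hgval
  exact ⟨f, hf, g, hg, by rw [hordθ] at hord; lia, hfval, hgval⟩

theorem card_lt_card_slopes_of_ord_pos {T : Finset (Γ.Point → ℝ)} (hT : T.Nonempty)
    (hPL : ∀ f ∈ T, Γ.IsPL f) {a : (Γ.Point → ℝ) → ℝ} {θ : Γ.Point → ℝ} (hθPL : Γ.IsPL θ)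
    (hθ : ∀ p, θ p = T.inf' hT fun f => f p + a f) {η : Γ.Tangent} {ε : ℝ} (hε : ε ≤ η.length)
    (haff : ∀ f ∈ T, IsAffineAlong f η ε) {Q : Finset ℝ} (hQ : ↑Q ⊆ Set.Ioo 0 ε)
    (hord : ∀ s ∈ Q, 0 < ord θ (η.path s)) : Q.card < (T.image (slope · η)).card := by
  classical
  have hval : ∀ h ∈ T, ∀ s ∈ Q, h (η.path s) + a h = (h η.base + a h) + slope h η * s :=
    fun h hh s hs => by rw [haff h hh s (hQ hs), add_right_comm]
  have hle : ∀ h ∈ T, ∀ s ∈ Q, θ (η.path s) ≤ (h η.base + a h) + slope h η * s :=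
    fun h hh s hs => by
      rw [← hval h hh s hs, hθ]
      exact Finset.inf'_le _ hh
  have hbreak : ∀ s ∈ Q, ∃ f ∈ T, ∃ g ∈ T, (slope f η : ℝ) < slope g η ∧
      ∀ h ∈ T, (f η.base + a f) + slope f η * s ≤ (h η.base + a h) + slope h η * s ∧
        (g η.base + a g) + slope g η * s ≤ (h η.base + a h) + slope h η * s := by
    intro s hs
    obtain ⟨f, hf, g, hg, hfg, hθf, hθg⟩ :=
      exists_slope_lt_slope_of_ord_pos hT hPL hθPL hθ hε haff (hQ hs) (hord s hs)
    rw [hval f hf s hs] at hθf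
    rw [hval g hg s hs] at hθg
    exact ⟨f, hf, g, hg, Int.cast_lt.2 hfg,
      fun h hh => ⟨hθf ▸ hle h hh s hs, hθg ▸ hle h hh s hs⟩⟩
  have hcard := card_breakpoints_lt_card_slopes hT (fun f => f η.base + a f) _ hbreak
  have himage : T.image (fun f => (slope f η : ℝ)) = (T.image (slope · η)).image (↑) := by
    rw [Finset.image_image]
    rfl
  rwa [himage, Finset.card_image_of_injective _ Int.cast_injective] at hcard

variable {D : Γ.Point →₀ ℤ} {r : ℕ} {L : Set (Γ.Point → ℝ)}

theorem subset_tropicalSpan {X : Type*} (S : Set (X → ℝ)) : S ⊆ tropicalSpan S := fun f hf =>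
  ⟨{f}, Finset.singleton_nonempty f, 0, by simpa using hf, fun p => by simp⟩

namespace IsTropicalLinearSeries

theorem isPL (hL : Γ.IsTropicalLinearSeries D r L) {f : Γ.Point → ℝ} (hf : f ∈ L) : Γ.IsPL f :=
  (hL.subset hf).1

theorem add_const_mem (hL : Γ.IsTropicalLinearSeries D r L) {f : Γ.Point → ℝ} (hf : f ∈ L)
    (c : ℝ) : (fun p => f p + c) ∈ L :=
  hL.submodule ⟨{f}, Finset.singleton_nonempty f, fun _ => c, by simpa using hf, fun p => by simp⟩

theorem infClosed (hL : Γ.IsTropicalLinearSeries D r L) : InfClosed L := by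
  classical
  intro f hf g hg
  refine hL.submodule ⟨{f, g}, Finset.insert_nonempty f {g}, 0, ?_, fun p => ?_⟩
  · simpa [Set.insert_subset_iff] using ⟨hf, hg⟩
  · simp [Finset.inf'_insert]

theorem exists_one_le_ord_add (hL : Γ.IsTropicalLinearSeries D r L) {Q : Finset Γ.Point}
    (hQ : Q.card = r) : ∃ θ ∈ L, ∀ p ∈ Q, 1 ≤ ord θ p + D p := by
  classical
  obtain ⟨θ, hθ, hdiv⟩ := hL.exists_div_ge (Finsupp.indicator Q fun _ _ => 1)
    (fun p => by rw [Finsupp.indicator_apply]; split_ifs <;> simp)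
    (by rw [Finsupp.sum_indicator_index _ fun _ _ => rfl]; simp [hQ])
  refine ⟨θ, hθ, fun p hp => ?_⟩
  simpa only [Finsupp.indicator_of_mem hp] using hdiv p

theorem infinite [hΓ : Nonempty Γ.Point] (hL : Γ.IsTropicalLinearSeries D r L) : L.Infinite := by
  obtain ⟨v⟩ := hΓ
  obtain ⟨f, hf, -⟩ := hL.exists_div_ge (Finsupp.single v r) (by simp) (by simp)
  refine Set.infinite_of_injective_forall_mem (f := fun (c : ℝ) p => f p + c) (fun c c' h => ?_)
    (hL.add_const_mem hf)
  exact add_left_cancel (congrFun h v)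

theorem encard_slopes_le (hL : Γ.IsTropicalLinearSeries D r L) (η : Γ.Tangent) :
    (slopes L η).encard ≤ r + 1 := by
  by_contra! hlt
  obtain ⟨S, hSL, hcard, hinj⟩ := exists_finset_injOn_of_le_encard_image (f := (slope · η)) (s := L)
    (k := r + 2) (Order.add_one_le_of_lt hlt)
  exact not_tropicallyDependent_of_injOn_slope (fun f hf => hL.isPL (hSL hf)) hinj
    (hL.dependent S hSL hcard)

/-- Choose `r` points outside `D` on a segment where all generators are affine. The function of the
series whose divisor contains these points has them as breakpoints, so it takes `r + 1` slopes. -/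
theorem le_encard_slopes (hL : Γ.IsTropicalLinearSeries D r L) (η : Γ.Tangent) :
    r + 1 ≤ (slopes L η).encard := by
  classical
  obtain ⟨S, rfl⟩ := hL.finitely_generated
  have hSPL : ∀ f ∈ S, Γ.IsPL f := fun f hf => hL.isPL (subset_tropicalSpan _ hf)
  obtain ⟨ε, hε, hεη, haff, hD⟩ := exists_forall_isAffineAlong hSPL D.support.finite_toSet η
  obtain ⟨Q, hQε, hQr⟩ := (Set.Ioo_infinite hε).exists_subset_card_eq r
  have hinj : Set.InjOn η.path Q :=
    η.injOn_path.mono (hQε.trans (Set.Ioo_subset_Ioo_right hεη))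
  obtain ⟨θ, hθ, hdiv⟩ :=
    hL.exists_one_le_ord_add (Q := Q.image η.path) ((Finset.card_image_of_injOn hinj).trans hQr)
  have hθPL := hL.isPL hθ
  obtain ⟨T, hT, a, hTS, hinf⟩ := hθ
  have hord : ∀ s ∈ Q, 0 < ord θ (η.path s) := fun s hs => by
    have hDs : D (η.path s) = 0 := by simpa using hD s (hQε hs)
    have hdivs := hdiv _ (Finset.mem_image_of_mem _ hs)
    rwa [hDs, add_zero] at hdivs
  have hcard : r < (T.image (slope · η)).card := hQr.symm.trans_lt <|
    card_lt_card_slopes_of_ord_pos hT (fun f hf => hSPL f (hTS hf)) hθPL hinf hεη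
      (fun f hf => haff f (hTS hf)) hQε hord
  calc (r + 1 : ℕ∞) ≤ (T.image (slope · η)).card := by exact_mod_cast hcard
    _ = (↑(T.image (slope · η)) : Set ℤ).encard := (Set.encard_coe_eq_coe_finsetCard _).symm
    _ ≤ _ := Set.encard_le_encard ?_
  rw [Finset.coe_image]
  exact Set.image_mono fun f hf => subset_tropicalSpan _ (hTS hf)

theorem encard_slopes (hL : Γ.IsTropicalLinearSeries D r L) (η : Γ.Tangent) :
    (slopes L η).encard = r + 1 :=
  (hL.encard_slopes_le η).antisymm (hL.le_encard_slopes η)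

theorem exists_slope_eq_inf (hL : Γ.IsTropicalLinearSeries D r L) {f g : Γ.Point → ℝ} (hf : f ∈ L)
    (hg : g ∈ L) (v : Γ.Point) :
    ∃ h ∈ L, ∀ η : Γ.Tangent, η.base = v → slope h η = slope f η ⊓ slope g η := by
  refine ⟨_, hL.infClosed (hL.add_const_mem hf (-f v)) (hL.add_const_mem hg (-g v)), ?_⟩
  rintro η rfl
  exact (((hL.isPL hf).isSlope_slope η |>.add_const _).inf
    ((hL.isPL hg).isSlope_slope η |>.add_const _) (by simp)).slope_eq

theorem exists_slope_le {n : ℕ} (hL : Γ.IsTropicalLinearSeries D n L) {S : Finset (Γ.Point → ℝ)}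
    (hSL : ↑S ⊆ L) (hcard : S.card = n + 1) {η ξ : Γ.Tangent} (hinj : Set.InjOn (slope · η) S)
    (hξ : ξ.base = η.base) {g : Γ.Point → ℝ} (hg : g ∈ L) : ∃ f ∈ S, slope f ξ ≤ slope g ξ := by
  classical
  by_cases hgS : g ∈ S
  · exact ⟨g, hgS, le_rfl⟩
  · have hins : ↑(insert g S) ⊆ L := by
      rw [Finset.coe_insert]
      exact Set.insert_subset hg hSL
    exact exists_slope_le_of_tropicallyDependent_insert (fun f hf => hL.isPL (hins hf)) hinj
      (hL.dependent _ hins (by rw [Finset.card_insert_of_notMem hgS, hcard])) hξ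

end IsTropicalLinearSeries

/-- A weakening of strong recursivity that suffices for the local structure: for all `n < r`, any
`n + 1` functions lie in a tropical linear subseries of rank `n`. -/
structure IsRecursive (Γ : MetricGraph V E) (D : Γ.Point →₀ ℤ) (r : ℕ) (L : Set (Γ.Point → ℝ)) :
    Prop extends IsTropicalLinearSeries Γ D r L where
  exists_subseries : ∀ n < r, ∀ S : Finset (Γ.Point → ℝ), ↑S ⊆ L → S.card = n + 1 →
    ∃ L' ⊆ L, ↑S ⊆ L' ∧ Γ.IsTropicalLinearSeries D n L'

theorem IsStronglyRecursive.isTropicalLinearSeries (hL : Γ.IsStronglyRecursive D r L) :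
    Γ.IsTropicalLinearSeries D r L := by
  rw [IsStronglyRecursive] at hL
  exact hL.1

theorem IsStronglyRecursive.isRecursive [Nonempty Γ.Point] (hL : Γ.IsStronglyRecursive D r L) :
    Γ.IsRecursive D r L := by
  refine ⟨hL.isTropicalLinearSeries, ?_⟩
  induction r generalizing L with
  | zero => simp
  | succ r ih =>
    intro n hn S hSL hS
    obtain ⟨S', hSS', hS'L, hS'⟩ := hL.isTropicalLinearSeries.infinite.exists_superset_ncard_eq hSL
      S.finite_toSet (k := r + 1) (by rw [Set.ncard_coe_finset, hS]; exact hn)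
    lift S' to Finset (Γ.Point → ℝ) using
      Set.finite_of_ncard_ne_zero (hS'.trans_ne r.succ_ne_zero)
    rw [Set.ncard_coe_finset] at hS'
    rw [IsStronglyRecursive] at hL
    obtain ⟨L', hL'L, hS'L', hL'⟩ := hL.2.1 r.succ_pos S' hS'L hS'
    rw [Nat.add_sub_cancel] at hL'
    have hSL' : ↑S ⊆ L' := hSS'.trans hS'L'
    obtain rfl | hnr := (Nat.lt_succ_iff.1 hn).eq_or_lt
    · exact ⟨L', hL'L, hSL', hL'.isTropicalLinearSeries⟩
    · obtain ⟨L'', hL'', hSL'', h⟩ := ih hL' n hnr S hSL' hS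
      exact ⟨L'', hL''.trans hL'L, hSL'', h⟩

theorem IsRecursive.encard_slopes_le_encard_slopes (hL : Γ.IsRecursive D r L) {ι : Type*}
    {v : Γ.Point} {η : ι → Γ.Tangent} (hη : ∀ i, (η i).base = v) (c : ι → ℤ) (i j : ι) :
    (slopes {f ∈ L | ∀ k, c k ≤ slope f (η k)} (η i)).encard ≤
      (slopes {f ∈ L | ∀ k, c k ≤ slope f (η k)} (η j)).encard := by
  rw [← ENat.forall_natCast_le_iff_le]
  rintro (_ | n) hn
  · simp
  obtain ⟨S, hS, hcard, hinj⟩ := exists_finset_injOn_of_le_encard_image (f := (slope · (η i))) hn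
  have hSL : ↑S ⊆ L := fun f hf => (hS hf).1
  have hnr : n + 1 ≤ r + 1 := by
    exact_mod_cast hn.trans ((Set.encard_le_encard (Set.image_mono fun f hf => hf.1)).trans
      (hL.encard_slopes_le (η i)))
  obtain ⟨L', hL'L, hSL', hL'⟩ : ∃ L' ⊆ L, ↑S ⊆ L' ∧ Γ.IsTropicalLinearSeries D n L' := by
    obtain rfl | hlt := (Nat.succ_le_succ_iff.1 hnr).eq_or_lt
    · exact ⟨L, le_rfl, hSL, hL.toIsTropicalLinearSeries⟩
    · exact hL.exists_subseries n hlt S hSL hcard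
  have hbound : L' ⊆ {f ∈ L | ∀ k, c k ≤ slope f (η k)} := fun g hg => by
    refine ⟨hL'L hg, fun k => ?_⟩
    obtain ⟨f, hf, hle⟩ := hL'.exists_slope_le hSL' hcard hinj ((hη k).trans (hη i).symm) hg
    exact ((hS hf).2 k).trans hle
  calc ((n + 1 : ℕ) : ℕ∞) = (slopes L' (η j)).encard := (hL'.encard_slopes (η j)).symm
    _ ≤ _ := Set.encard_le_encard (Set.image_mono hbound)

section LocalArray

variable {d : ℕ} {η : Fin d → Γ.Tangent} (e : ∀ i, Fin (r + 1) ≃o slopes L (η i))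

theorem isNthSlope_iff {τ : Γ.Tangent} (e : Fin (r + 1) ≃o slopes L τ) {k : Fin (r + 1)} {m : ℤ} :
    IsNthSlope L τ k m ↔ m = e k := by
  constructor
  · rintro ⟨hm, hk⟩
    obtain ⟨l, rfl⟩ : ∃ l, m = e l := ⟨e.symm ⟨m, hm⟩, by simp⟩
    rw [encard_lt_finOrderIso e, Nat.cast_inj] at hk
    rw [Fin.ext hk]
  · rintro rfl
    exact ⟨(e k).2, encard_lt_finOrderIso e k⟩

include e

theorem mem_localArray_iff {x : Fin d → Fin (r + 1)} :
    x ∈ localArray L r η ↔ ∃ f ∈ L, ∀ i, slope f (η i) = e i (x i) := by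
  simp only [localArray, Set.mem_ofPred_eq, isNthSlope_iff (e _)]

theorem exists_mem_localArray {f : Γ.Point → ℝ} (hf : f ∈ L) :
    ∃ y ∈ localArray L r η, ∀ i, slope f (η i) = e i (y i) := by
  have hy : ∀ i, slope f (η i) = e i ((e i).symm ⟨slope f (η i), f, hf, rfl⟩) := by simp
  exact ⟨_, (mem_localArray_iff e).2 ⟨f, hf, hy⟩, hy⟩

theorem slopes_eq_image_principal (x : Fin d → Fin (r + 1)) (i : Fin d) :
    slopes {f ∈ L | ∀ k, (e k (x k) : ℤ) ≤ slope f (η k)} (η i) =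
      (fun k => (e i k : ℤ)) '' ((· i) '' DotArray.principal (localArray L r η) x) := by
  ext m
  constructor
  · rintro ⟨f, ⟨hf, hx⟩, rfl⟩
    obtain ⟨y, hy, hfy⟩ := exists_mem_localArray e hf
    refine ⟨y i, ⟨y, ⟨hy, fun k => (e k).le_iff_le.1 ?_⟩, rfl⟩, (hfy i).symm⟩
    exact (hx k).trans_eq (hfy k)
  · rintro ⟨_, ⟨y, ⟨hy, hxy⟩, rfl⟩, rfl⟩
    obtain ⟨f, hf, hfy⟩ := (mem_localArray_iff e).1 hy
    exact ⟨f, ⟨hf, fun k => (hfy k).symm ▸ (e k).monotone (hxy k)⟩, hfy i⟩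

theorem hasRank_localArray : DotArray.HasRank (localArray L r η) r := by
  intro i
  have hsurj : (· i) '' localArray L r η = Set.univ := by
    refine Set.eq_univ_of_forall fun k => ?_
    obtain ⟨f, hf, hfk⟩ := (e i k).2
    obtain ⟨y, hy, hfy⟩ := exists_mem_localArray e hf
    exact ⟨y, hy, (e i).injective (Subtype.ext ((hfy i).symm.trans hfk))⟩
  rw [DotArray.axisRank, hsurj, Set.ncard_univ, Nat.card_fin]
  simp

theorem IsTropicalLinearSeries.infClosed_localArray (hL : Γ.IsTropicalLinearSeries D r L)
    {v : Γ.Point} (hη : ∀ i, (η i).base = v) : InfClosed (localArray L r η) := by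
  intro x hx y hy
  obtain ⟨f, hf, hfx⟩ := (mem_localArray_iff e).1 hx
  obtain ⟨g, hg, hgy⟩ := (mem_localArray_iff e).1 hy
  obtain ⟨h, hh, hinf⟩ := hL.exists_slope_eq_inf hf hg v
  have hmono : ∀ i, Monotone fun k => (e i k : ℤ) := fun i => (e i).monotone
  exact (mem_localArray_iff e).2 ⟨h, hh, fun i => by
    rw [hinf _ (hη i), hfx, hgy, Pi.inf_apply, (hmono i).map_inf]⟩

theorem IsRecursive.totallyRankable_localArray (hL : Γ.IsRecursive D r L)
    {v : Γ.Point} (hη : ∀ i, (η i).base = v) : DotArray.TotallyRankable (localArray L r η) := by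
  rw [DotArray.totallyRankable_iff_ncard_image_eq]
  intro x i j
  have hle := hL.encard_slopes_le_encard_slopes hη fun k => e k (x k)
  have hinj : ∀ i, Function.Injective fun k => (e i k : ℤ) := fun i =>
    Subtype.val_injective.comp (e i).injective
  have hij := (hle i j).antisymm (hle j i)
  rw [slopes_eq_image_principal, slopes_eq_image_principal, (hinj i).encard_image,
    (hinj j).encard_image] at hij
  rw [Set.ncard, hij, Set.ncard]

end LocalArray

end MetricGraph

theorem mainTheorem2_general {V E : Type*} (Γ : MetricGraph V E) (D : Γ.Point →₀ ℤ) (r : ℕ)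
    (L : Set (Γ.Point → ℝ)) (hL : Γ.IsRecursive D r L) (v : Γ.Point) (d : ℕ)
    (η : Fin d → Γ.Tangent) (hη : ∀ i, (η i).base = v) :
    (∀ i, (MetricGraph.slopes L (η i)).encard = r + 1) ∧
    ∃ P : DotArray r d, DotArray.IsPermutationArray P ∧
      MetricGraph.localArray L r η = DotArray.redundantClosure P := by
  have hcard : ∀ i, (MetricGraph.slopes L (η i)).encard = r + 1 := fun i => hL.encard_slopes (η i)
  have e : ∀ i, Fin (r + 1) ≃o MetricGraph.slopes L (η i) := fun i =>
    (nonempty_finOrderIso_of_encard_eq (hcard i)).some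
  have htot := hL.totallyRankable_localArray e hη
  have hinf := hL.infClosed_localArray e hη
  exact ⟨hcard, DotArray.core _, htot.isPermutationArray_core (MetricGraph.hasRank_localArray e),
    (htot.redundantClosure_core hinf).symm⟩

theorem mainTheorem2 {V E : Type*} [Finite V] [Finite E] (Γ : MetricGraph V E)
    (D : Γ.Point →₀ ℤ) (r : ℕ) (L : Set (Γ.Point → ℝ)) (hL : Γ.IsStronglyRecursive D r L)
    (v : Γ.Point) (d : ℕ) (η : Fin d ≃ Γ.tangentsAt v) :
    (∀ i, (MetricGraph.slopes L (η i)).encard = r + 1) ∧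
    ∃ P : DotArray r d, DotArray.IsPermutationArray P ∧
      MetricGraph.localArray L r (fun i => (η i : Γ.Tangent)) = DotArray.redundantClosure P := by
  have : Nonempty Γ.Point := ⟨v⟩
  exact mainTheorem2_general Γ D r L hL.isRecursive v d (fun i => η i) fun i => (η i).2
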